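/- Let $p,n\ge 1$ be integers and $J=\begin{bmatrix}0&I_p\\ I_p&0\end{bmatrix}$. For $2p\times 2p$ matrices $Q_0,\dots,Q_{n-1}$, consider the (discrete) system $$y_{k+1}=w_{k+1}(\lambda)y_k,\qquad w_{k+1}(\lambda)=I_{2p}+\frac{\mathrm i}{\lambda}JQ_k\qquad(0\le k<n,\ \lambda\in\mathbb C\setminus\{0\}).\tag{1}$$ Let $H(n)=\{H_{i+j-2}\}_{i,j=1}^n>0$ be a positive definite block Hankel matrix with $p\times p$ complex blocks $H_0,\dots,H_{2n-2}$, and put $H(m)=\{H_{i+j-2}\}_{i,j=1}^m$ and $T(m)=H(m)^{-1}$ for $1\le m\le n$. Let $\Pi(m)=\begin{bmatrix}\Phi_1(m)&\Phi_2(m)\end{bmatrix}$, where $\Phi_1(m)$ and $\Phi_2(m)$ are the block columns with $m$ blocks $$\Phi_1(m)=-\mathrm i\begin{bmatrix}0\\H_0\\H_1\\ \vdots\\H_{m-2}\end{bmatrix},\qquad \Phi_2(m)=\begin{bmatrix}I_p\\0\\ \vdots\\0\end{bmatrix},$$ and let $P_2(m)=\begin{bmatrix}0&\dots&0&I_p\end{bmatrix}\in\mathbb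 C^{p\times pm}$. For $1\le k<n$ let $\mathcal H_{12}(k+1)$ be the block column with blocks $H_k,\dots,H_{2k-1}$ and $$t_{k+1}=\big(H_{2k}-\mathcal H_{12}(k+1)^*T(k)\mathcal H_{12}(k+1)\big)^{-1}.$$ The canonical system generated by $H(n)$ is the system (1) with $$Q_0=\begin{bmatrix}0\\I_p\end{bmatrix}H_0^{-1}\begin{bmatrix}0&I_p\end{bmatrix},\qquad Q_k=\Pi(k+1)^*T(k+1)P_2(k+1)^*\,t_{k+1}^{-1}\,P_2(k+1)T(k+1)\Pi(k+1)\quad(1\le k<n).$$ Then, for each fixed $n$ (and $p$), the set of canonical systems generated by the block Hankel matrices $H(n)>0$ coincides with the set of systems (1) such that $Q_k=\gamma_k^*\gamma_k$ $(0\le k<n)$ for some matrices $\gamma_0,\dots,\gamma_{n-1}\in\mathbb C^{p\times 2p}$ satisfying $$\gamma_0\begin{bmatrix}I_p\\0\end{bmatrix}=0,\qquad \gamma_kJ\gamma_k^*=0,\quad \det(\gamma_{k-1}J\gamma_k^*)\ne0\quad(0<k<n),$$ and, in the case $n=1$, also $\det\Big(\gamma_0\begin{bmatrix}0\\I_p\end{bmatrix}\Big)\neq0$.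 -/

import Mathlib

open scoped ComplexOrder

namespace HankelCanonical

/-- The `2p × 2p` matrix `J = [0 I; I 0]`. -/
def matJ (p : ℕ) : Matrix (Fin p ⊕ Fin p) (Fin p ⊕ Fin p) ℂ :=
  Matrix.fromBlocks 0 1 1 0

/-- The `2p × p` block column `[I; 0]`. -/
def colFst (p : ℕ) : Matrix (Fin p ⊕ Fin p) (Fin p) ℂ := Matrix.fromRows 1 0

/-- The `2p × p` block column `[0; I]`. -/
def colSnd (p : ℕ) : Matrix (Fin p ⊕ Fin p) (Fin p) ℂ := Matrix.fromRows 0 1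

/-- The `2p × 2p` coefficient `w(z) = I + (i / z) J Q` (spectral parameter `z ≠ 0`). -/
noncomputable def coeff {p : ℕ} (Q : Matrix (Fin p ⊕ Fin p) (Fin p ⊕ Fin p) ℂ)
    (z : {z : ℂ // z ≠ 0}) : Matrix (Fin p ⊕ Fin p) (Fin p ⊕ Fin p) ℂ :=
  1 + (Complex.I / (z : ℂ)) • (matJ p * Q)

/-- The system `y_{k+1} = (I + (i / z) J Q_k) y_k`, `0 ≤ k < n`, as a relation between the
spectral parameter `z ≠ 0` and the sequence `y_0, …, y_n` of vectors in `ℂ^{2p}`. -/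
def canonicalSystem {p n : ℕ} (Q : Fin n → Matrix (Fin p ⊕ Fin p) (Fin p ⊕ Fin p) ℂ) :
    {z : ℂ // z ≠ 0} → (Fin (n + 1) → (Fin p ⊕ Fin p → ℂ)) → Prop :=
  fun z y => ∀ k : Fin n, y k.succ = (coeff (Q k) z).mulVec (y k.castSucc)

section Hankel

variable {p : ℕ} (H : ℕ → Matrix (Fin p) (Fin p) ℂ)

/-- The block Hankel matrix `H(m) = {H_{i+j}}`, `0 ≤ i, j < m`; its blocks are
`H_0, …, H_{2m-2}`. -/
def blockHankel (m : ℕ) : Matrix (Fin m × Fin p) (Fin m × Fin p) ℂ :=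
  Matrix.of fun i j => H ((i.1 : ℕ) + (j.1 : ℕ)) i.2 j.2

/-- `T(m) = H(m)⁻¹`. -/
noncomputable def matT (m : ℕ) : Matrix (Fin m × Fin p) (Fin m × Fin p) ℂ :=
  (blockHankel H m)⁻¹

/-- The block column `Φ₁(m) = -i [0; H_0; H_1; …; H_{m-2}]`. -/
noncomputable def matPhi₁ (m : ℕ) : Matrix (Fin m × Fin p) (Fin p) ℂ :=
  Matrix.of fun i b =>
    if (i.1 : ℕ) = 0 then 0 else -Complex.I * H ((i.1 : ℕ) - 1) i.2 b

/-- The block column `Φ₂(m) = [I; 0; …; 0]`. -/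
def matPhi₂ (p m : ℕ) : Matrix (Fin m × Fin p) (Fin p) ℂ :=
  Matrix.of fun i b => if (i.1 : ℕ) = 0 then (1 : Matrix (Fin p) (Fin p) ℂ) i.2 b else 0

/-- `Π(m) = [Φ₁(m) Φ₂(m)]`. -/
noncomputable def matPi (m : ℕ) : Matrix (Fin m × Fin p) (Fin p ⊕ Fin p) ℂ :=
  Matrix.fromCols (matPhi₁ H m) (matPhi₂ p m)

/-- The block row `P₂(m) = [0 … 0 I]` with `m` blocks. -/
def matP₂ (p m : ℕ) : Matrix (Fin p) (Fin m × Fin p) ℂ :=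
  Matrix.of fun a j => if (j.1 : ℕ) + 1 = m then (1 : Matrix (Fin p) (Fin p) ℂ) a j.2 else 0

/-- The block column `[H_k; …; H_{2k-1}]`, that is, the upper right part of
`H(k+1)` in its partition with upper left part `H(k)` and lower right part `H_{2k}`. -/
def colH₁₂ (k : ℕ) : Matrix (Fin k × Fin p) (Fin p) ℂ :=
  Matrix.of fun i b => H (k + (i.1 : ℕ)) i.2 b

/-- `t_{k+1} = (H_{2k} - H₂₁ T(k) H₁₂)⁻¹`, with `H₂₁ = H₁₂^*` (for `k = 0` this is `H_0⁻¹`). -/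
noncomputable def matt (k : ℕ) : Matrix (Fin p) (Fin p) ℂ :=
  (H (2 * k) - (colH₁₂ H k).conjTranspose * matT H k * colH₁₂ H k)⁻¹

/-- The Hamiltonian of the canonical system generated by the block Hankel matrix:
`Q_0 = [0; I] H_0⁻¹ [0 I]` and, for `k ≥ 1`,
`Q_k = Π(k+1)^* T(k+1) P₂^* t_{k+1}⁻¹ P₂ T(k+1) Π(k+1)`.
For `k < n` it involves only the blocks `H_0, …, H_{2n-2}` of `H(n)`. -/
noncomputable def hankelHamiltonian (k : ℕ) : Matrix (Fin p ⊕ Fin p) (Fin p ⊕ Fin p) ℂ :=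
  if k = 0 then colSnd p * (H 0)⁻¹ * (colSnd p).conjTranspose
  else (matPi H (k + 1)).conjTranspose * matT H (k + 1) * (matP₂ p (k + 1)).conjTranspose
    * (matt H k)⁻¹ * matP₂ p (k + 1) * matT H (k + 1) * matPi H (k + 1)

end Hankel

/-- A canonical system determines its Hamiltonian, so that an equality of canonical systems is
the equality of all the matrices `Q_k`. -/
theorem canonicalSystem_injective {p n : ℕ} :
    Function.Injective (canonicalSystem (p := p) (n := n)) := by
  intro Q Q' h
  have hev : ∀ k : Fin n, ∀ᶠ c : ℂ in nhdsWithin 0 {0}ᶜ, (1 + c • (matJ p * Q k)).det ≠ 0 := by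
    intro k
    have hc : Continuous fun c : ℂ => (1 + c • (matJ p * Q k)).det := by fun_prop
    have h0 : (fun c : ℂ => (1 + c • (matJ p * Q k)).det) 0 ≠ 0 := by simp
    exact (hc.continuousAt.eventually_ne h0).filter_mono nhdsWithin_le_nhds
  obtain ⟨c, hdet, hc⟩ :=
    ((Filter.eventually_all.2 hev).and (self_mem_nhdsWithin)).exists
  have hc0 : c ≠ 0 := hc
  let z : {z : ℂ // z ≠ 0} := ⟨Complex.I / c, div_ne_zero Complex.I_ne_zero hc0⟩
  have hz : Complex.I / (z : ℂ) = c := by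
    simp only [z]
    field_simp
  let Y : ℕ → Matrix (Fin p ⊕ Fin p) (Fin p ⊕ Fin p) ℂ := fun m =>
    Nat.rec 1 (fun m Ym => (if hm : m < n then coeff (Q ⟨m, hm⟩) z else 1) * Ym) m
  have hYs : ∀ k : Fin n, Y (k + 1) = coeff (Q k) z * Y k := by
    intro k
    change (if hm : (k : ℕ) < n then coeff (Q ⟨k, hm⟩) z else 1) * Y k = _
    rw [dif_pos k.2]
  have hYu : ∀ m, m ≤ n → IsUnit (Y m) := by
    intro m
    induction m with
    | zero => intro _; exact isUnit_one
    | succ m ih =>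
      intro hm
      rw [hYs ⟨m, hm⟩]
      refine IsUnit.mul ?_ (ih (Nat.le_of_succ_le hm))
      rw [Matrix.isUnit_iff_isUnit_det, isUnit_iff_ne_zero, coeff, hz]
      exact hdet _
  have hsol : ∀ v : Fin p ⊕ Fin p → ℂ, canonicalSystem Q z fun j => (Y j).mulVec v := by
    intro v k
    simp [hYs k]
  funext k
  have hmul : coeff (Q' k) z * Y k = coeff (Q k) z * Y k := by
    apply Matrix.toLin'.injective
    apply LinearMap.ext
    intro v
    have h1 := hsol v k
    have h2 := hsol v
    rw [h] at h2
    have h3 := h2 k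
    rw [h1] at h3
    simpa using h3.symm
  have hco := (hYu k k.2.le).mul_right_cancel hmul
  rw [coeff, coeff, hz] at hco
  have hJQ := smul_right_injective _ hc0 (add_left_cancel hco)
  have hJ : matJ p * matJ p = 1 := by
    simp [matJ, Matrix.fromBlocks_multiply, Matrix.fromBlocks_one]
  have h4 := congrArg (fun M => matJ p * M) hJQ
  simp only [← Matrix.mul_assoc, hJ, Matrix.one_mul] at h4
  exact h4.symm

end HankelCanonical

/-! Let h_k be the Schur complement of H(k) in H(k+1) and let Y_k (`lagr`) be the p × 2p row [-H₂₁
T(k), I] Π(k+1), built from the k-th monic matrix orthogonal polynomial. Then Q_k = Y_k^* h_k⁻¹ Y_k.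
Orthogonality and summation by parts give Y_k J Y_k^* = 0 and Y_{k+1} J Y_k^* = -i h_k, so a
factorization h_k⁻¹ = v^* v makes γ_k = v Y_k satisfy all the conditions.

The converse builds H two blocks at a time (`exists_extension`). Given H_0, …, H_{2k}, let W be the
row Y_{k+1} for the trial value H_{2k+1} = 0. The rows Y_k, W are isotropic and paired by an
invertible block, so γ_{k+1} = A Y_k + u W. The determinant condition makes u invertible, and
isotropy makes D = -u⁻¹ A h_k Hermitian. Taking H_{2k+1} = D turns W into u⁻¹ γ_{k+1}. The block
H_{2k+2} does not enter Y_{k+1} and is free to give h_{k+1} = (u^* u)⁻¹ > 0, which keeps the Hankel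
matrix positive definite. -/

namespace HankelCanonical

open Finset
open scoped Matrix

/-! ### Orthogonal polynomial coefficients and Schur complements -/

section Coefficients

variable {p : ℕ} (H : ℕ → Matrix (Fin p) (Fin p) ℂ)

/-- The Schur complement `h_k = H_{2k} - H₂₁ T(k) H₁₂`, whose inverse is `t_{k+1}`. -/
noncomputable def schur (k : ℕ) : Matrix (Fin p) (Fin p) ℂ :=
  H (2 * k) - (colH₁₂ H k)ᴴ * matT H k * colH₁₂ H k

/-- The coefficients `[-H₂₁ T(k), I]` of the monic matrix orthogonal polynomial of degree `k`,
extended by zero. -/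
noncomputable def coef (k j : ℕ) : Matrix (Fin p) (Fin p) ℂ :=
  if h : j < k then -Matrix.of fun a b => ((colH₁₂ H k)ᴴ * matT H k) a (⟨j, h⟩, b)
  else if j = k then 1 else 0

theorem coef_self (k : ℕ) : coef H k k = 1 := by simp [coef]

theorem coef_of_lt {k j : ℕ} (h : k < j) : coef H k j = 0 := by
  simp [coef, h.not_gt, h.ne']

/-- The `p × 2p` matrix `[-H₂₁ T(k), I] Π(k+1)`. -/
noncomputable def lagr (k : ℕ) : Matrix (Fin p) (Fin p ⊕ Fin p) ℂ :=
  Matrix.fromCols (-Complex.I • ∑ j ∈ range k, coef H k (j + 1) * H j) (coef H k 0)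

theorem lagr_zero : lagr H 0 = (colSnd p)ᴴ := by
  simp [lagr, colSnd, coef_self, Matrix.conjTranspose_fromRows_eq_fromCols_conjTranspose]

theorem schur_zero : schur H 0 = H 0 := by
  ext a b
  simp [schur, Matrix.mul_apply]

variable {H}

theorem isUnit_det_of_posDef {m : Type*} [Fintype m] [DecidableEq m] {A : Matrix m m ℂ}
    (h : A.PosDef) : IsUnit A.det :=
  (Matrix.isUnit_iff_isUnit_det _).1 h.isUnit

/-- Orthogonality to lower powers: H₂₁ T(k) H(k) = H₂₁, read in block l. Since H₂₁ is defined as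
H₁₂^*, the block H_{k+l} has to be Hermitian. -/
theorem sum_coef_mul_of_lt {k l : ℕ} (hk : IsUnit (blockHankel H k).det) (hl : l < k)
    (hH : (H (k + l))ᴴ = H (k + l)) :
    ∑ j ∈ range (k + 1), coef H k j * H (j + l) = 0 := by
  have h1 : (colH₁₂ H k)ᴴ * matT H k * blockHankel H k = (colH₁₂ H k)ᴴ := by
    rw [matT, Matrix.mul_assoc, Matrix.nonsing_inv_mul _ hk, Matrix.mul_one]
  rw [sum_range_succ, coef_self, Matrix.one_mul]
  ext a b
  have h2 := congrFun (congrFun h1 a) (⟨l, hl⟩, b)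
  rw [Matrix.mul_apply, Fintype.sum_prod_type] at h2
  have h3 : (colH₁₂ H k)ᴴ a (⟨l, hl⟩, b) = H (k + l) a b := by
    rw [← hH]; rfl
  rw [h3] at h2
  rw [Matrix.add_apply, ← h2, Matrix.sum_apply, sum_range, ← sum_add_distrib]
  refine sum_eq_zero fun i _ => ?_
  simp [coef, i.2, Matrix.mul_apply, blockHankel]

theorem sum_coef_mul_self (k : ℕ) :
    ∑ j ∈ range (k + 1), coef H k j * H (j + k) = schur H k := by
  rw [sum_range_succ, coef_self, Matrix.one_mul, schur, ← two_mul]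
  ext a b
  rw [Matrix.add_apply, Matrix.sub_apply, Matrix.mul_apply, Fintype.sum_prod_type,
    Matrix.sum_apply, sum_range, sub_eq_neg_add, ← sum_neg_distrib]
  congr 1
  refine sum_congr rfl fun i _ => ?_
  simp [coef, i.2, Matrix.mul_apply, colH₁₂, add_comm]

/-- The row `[-H₂₁ T(k), I]` as a matrix. -/
noncomputable def coefRow (H : ℕ → Matrix (Fin p) (Fin p) ℂ) (k m : ℕ) :
    Matrix (Fin p) (Fin m × Fin p) ℂ :=
  Matrix.of fun a j => coef H k j.1 a j.2

/-- Orthogonality in matrix form; inverting H(k+1) identifies the row P₂ T(k+1) in Q_k with h_k⁻¹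
[-H₂₁ T(k), I]. -/
theorem coefRow_mul_blockHankel {k : ℕ} (hk : IsUnit (blockHankel H k).det)
    (hH : ∀ j ≤ 2 * k, (H j)ᴴ = H j) :
    coefRow H k (k + 1) * blockHankel H (k + 1) = schur H k * matP₂ p (k + 1) := by
  ext a ⟨l, b⟩
  have h1 : (coefRow H k (k + 1) * blockHankel H (k + 1)) a (l, b) =
      (∑ j ∈ range (k + 1), coef H k j * H (j + l)) a b := by
    rw [Matrix.mul_apply, Fintype.sum_prod_type, Matrix.sum_apply, sum_range]
    simp [coefRow, blockHankel, Matrix.mul_apply]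
  rw [h1]
  rcases (Nat.lt_succ_iff.1 l.2).lt_or_eq with hl | hl
  · rw [sum_coef_mul_of_lt hk hl (hH _ (by omega))]
    simp [Matrix.mul_apply, matP₂, hl.ne]
  · rw [hl, sum_coef_mul_self]
    simp [Matrix.mul_apply, matP₂, hl, Matrix.one_apply]

theorem coefRow_mul_matPi (k : ℕ) :
    coefRow H k (k + 1) * matPi H (k + 1) = lagr H k := by
  rw [matPi, Matrix.mul_fromCols, lagr]
  congr 1
  · ext a b
    rw [Matrix.mul_apply, Fintype.sum_prod_type, Fin.sum_univ_succ, Matrix.smul_apply,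
      Matrix.sum_apply, sum_range]
    simp [coefRow, matPhi₁, Matrix.mul_apply, mul_sum, mul_left_comm]
  · ext a b
    rw [Matrix.mul_apply, Fintype.sum_prod_type, Fin.sum_univ_succ]
    simp [coefRow, matPhi₂, Matrix.one_apply]

theorem schur_mul_matP₂_mul_matT {k : ℕ} (hk : IsUnit (blockHankel H k).det)
    (hk1 : IsUnit (blockHankel H (k + 1)).det) (hH : ∀ j ≤ 2 * k, (H j)ᴴ = H j) :
    schur H k * (matP₂ p (k + 1) * matT H (k + 1)) = coefRow H k (k + 1) := by
  rw [← Matrix.mul_assoc, ← coefRow_mul_blockHankel hk hH, Matrix.mul_assoc, matT,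
    Matrix.mul_nonsing_inv _ hk1, Matrix.mul_one]

theorem coefRow_mul_matP₂ (k : ℕ) :
    coefRow H k (k + 1) * (matP₂ p (k + 1))ᴴ = 1 := by
  ext a b
  rw [Matrix.mul_apply, Fintype.sum_prod_type, Fin.sum_univ_castSucc, sum_eq_zero]
  · simp [coefRow, coef_self, matP₂, Matrix.one_apply, apply_ite]
  · intro i _
    simp [matP₂, i.2.ne]

theorem posDef_blockHankel_mono {k m : ℕ} (h : k ≤ m) (hm : (blockHankel H m).PosDef) :
    (blockHankel H k).PosDef := by
  refine hm.submatrix (e := fun x : Fin k × Fin p => (Fin.castLE h x.1, x.2)) ?_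
  rintro ⟨a, b⟩ ⟨c, d⟩ hh
  simpa using hh

/-- In a Hankel matrix the same block H_j stands at positions (a, b) and (b, a) with a + b = j; here
a = ⌊j/2⌋, b = ⌈j/2⌉. -/
theorem conjTranspose_of_posDef {m j : ℕ} (hm : (blockHankel H m).PosDef) (hj : j + 1 < 2 * m) :
    (H j)ᴴ = H j := by
  ext a b
  have h1 : j / 2 < m := by omega
  have h2 : j - j / 2 < m := by omega
  have h3 := congrFun (congrFun hm.1.eq (⟨j / 2, h1⟩, a)) (⟨j - j / 2, h2⟩, b)
  have h4 : j / 2 + (j - j / 2) = j := by omega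
  have h5 : j - j / 2 + j / 2 = j := by omega
  simpa [blockHankel, h4, h5] using h3

/-- The inverse of h_k is the last diagonal block P₂ T(k+1) P₂^* of a positive definite matrix. -/
theorem posDef_schur {k : ℕ} (hk : (blockHankel H (k + 1)).PosDef) : (schur H k).PosDef := by
  have h1 : schur H k * (matP₂ p (k + 1) * matT H (k + 1) * (matP₂ p (k + 1))ᴴ) = 1 := by
    rw [← Matrix.mul_assoc, schur_mul_matP₂_mul_matT
      (isUnit_det_of_posDef (posDef_blockHankel_mono k.le_succ hk)) (isUnit_det_of_posDef hk)
      fun j hj => conjTranspose_of_posDef hk (by omega), coefRow_mul_matP₂]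
  rw [← Matrix.inv_eq_left_inv h1]
  refine (Matrix.PosDef.mul_mul_conjTranspose_same hk.inv ?_).inv
  intro v w hvw
  funext b
  have := congrFun hvw (Fin.last k, b)
  simpa [Matrix.vecMul, dotProduct, matP₂, Matrix.one_apply] using this

theorem posDef_blockHankel_succ {k : ℕ} (hk : (blockHankel H k).PosDef)
    (hH : ∀ j ≤ 2 * k, (H j)ᴴ = H j) (hs : (schur H k).PosDef) :
    (blockHankel H (k + 1)).PosDef := by
  let _ := Matrix.invertibleOfIsUnitDet _ (isUnit_det_of_posDef hk)
  have h1 : (Matrix.fromBlocks (blockHankel H k) (colH₁₂ H k) (colH₁₂ H k)ᴴ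
      (H (2 * k))).PosDef := by
    -- Semidefiniteness follows from that of the Schur complement; definiteness then only needs det
    -- H(k) · det h_k ≠ 0.
    rw [((Matrix.PosDef.fromBlocks₁₁ _ _ hk).2 hs.posSemidef).posDef_iff_det_ne_zero,
      Matrix.det_fromBlocks₁₁, Matrix.invOf_eq_nonsing_inv]
    exact mul_ne_zero (isUnit_det_of_posDef hk).ne_zero (isUnit_det_of_posDef hs).ne_zero
  let e : Fin (k + 1) × Fin p → (Fin k × Fin p) ⊕ Fin p := fun x =>
    if h : (x.1 : ℕ) < k then Sum.inl (⟨x.1, h⟩, x.2) else Sum.inr x.2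
  have he : Function.Injective e := by
    rintro ⟨a, b⟩ ⟨c, d⟩ h
    by_cases ha : (a : ℕ) < k <;> by_cases hc : (c : ℕ) < k <;> simp [e, ha, hc] at h
    · simpa [Fin.ext_iff] using h
    · simp only [h, Prod.mk.injEq, and_true, Fin.ext_iff]
      omega
  convert h1.submatrix he using 1
  ext ⟨a, b⟩ ⟨c, d⟩
  by_cases ha : (a : ℕ) < k <;> by_cases hc : (c : ℕ) < k
  · simp [e, ha, hc, blockHankel]
  · have : (c : ℕ) = k := by omega
    simp [e, ha, blockHankel, colH₁₂, this, add_comm]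
  · have hak : (a : ℕ) = k := by omega
    have := congrFun (congrFun (hH (k + c) (by omega)) b) d
    simp [e, hc, blockHankel, colH₁₂, hak, ← this]
  · have hak : (a : ℕ) = k := by omega
    have hck : (c : ℕ) = k := by omega
    simp [e, blockHankel, hak, hck, two_mul]

theorem hankelHamiltonian_eq {k : ℕ} (hk : (blockHankel H (k + 1)).PosDef) :
    hankelHamiltonian H k = (lagr H k)ᴴ * (schur H k)⁻¹ * lagr H k := by
  have hs := posDef_schur hk
  rcases k.eq_zero_or_pos with rfl | hk0
  · simp [hankelHamiltonian, lagr_zero, schur_zero]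
  · have hX : matP₂ p (k + 1) * matT H (k + 1) * matPi H (k + 1) =
        (schur H k)⁻¹ * lagr H k := by
      rw [← coefRow_mul_matPi, ← schur_mul_matP₂_mul_matT
        (isUnit_det_of_posDef (posDef_blockHankel_mono k.le_succ hk)) (isUnit_det_of_posDef hk)
        fun j hj => conjTranspose_of_posDef hk (by omega), Matrix.mul_assoc (schur H k),
        Matrix.nonsing_inv_mul_cancel_left _ _ (isUnit_det_of_posDef hs)]
    have hX' : (matPi H (k + 1))ᴴ * matT H (k + 1) * (matP₂ p (k + 1))ᴴ =
        (lagr H k)ᴴ * (schur H k)⁻¹ := by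
      have := congrArg Matrix.conjTranspose hX
      have hT : (matT H (k + 1))ᴴ = matT H (k + 1) := hk.inv.1.eq
      rw [Matrix.conjTranspose_mul, Matrix.conjTranspose_mul, Matrix.conjTranspose_mul, hT,
        hs.inv.1.eq] at this
      rw [← this, Matrix.mul_assoc]
    have ht : (matt H k)⁻¹ = schur H k :=
      Matrix.nonsing_inv_nonsing_inv _ (isUnit_det_of_posDef hs)
    rw [hankelHamiltonian, if_neg hk0.ne', hX', ht, Matrix.mul_assoc _ (matP₂ p (k + 1)),
      Matrix.mul_assoc _ _ (matPi H (k + 1)), hX,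
      Matrix.nonsing_inv_mul_cancel_right _ _ (isUnit_det_of_posDef hs), Matrix.mul_assoc]

end Coefficients

/-! ### The J-pairing of the rows Y_k -/

section Pairing

variable {p : ℕ} {H : ℕ → Matrix (Fin p) (Fin p) ℂ}

theorem fromCols_mul_matJ_mul (a b c d : Matrix (Fin p) (Fin p) ℂ) :
    Matrix.fromCols a b * matJ p * (Matrix.fromCols c d)ᴴ = a * dᴴ + b * cᴴ := by
  rw [matJ, Matrix.fromCols_mul_fromBlocks,
    Matrix.conjTranspose_fromCols_eq_fromRows_conjTranspose, Matrix.fromCols_mul_fromRows]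
  simp [add_comm]

/-- Summation by parts for the shift on block sequences. -/
theorem shift_pairing (c d : ℕ → Matrix (Fin p) (Fin p) ℂ) (k : ℕ) :
    (∑ i ∈ range k, c (i + 1) * H i) * d 0 - c 0 * ∑ j ∈ range k, H j * d (j + 1) =
      ∑ i ∈ range k, c (i + 1) * ∑ j ∈ range (k + 1), H (j + i) * d j -
        ∑ j ∈ range k, (∑ i ∈ range (k + 1), c i * H (i + j)) * d (j + 1) := by
  have h1 : ∑ i ∈ range k, c (i + 1) * ∑ j ∈ range (k + 1), H (j + i) * d j =
      (∑ i ∈ range k, ∑ j ∈ range k, c (i + 1) * H (i + j + 1) * d (j + 1)) +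
        (∑ i ∈ range k, c (i + 1) * H i) * d 0 := by
    rw [sum_mul, ← sum_add_distrib]
    refine sum_congr rfl fun i _ => ?_
    have hi (j : ℕ) : j + 1 + i = i + j + 1 := by omega
    rw [sum_range_succ', mul_add, mul_sum]
    simp only [hi, zero_add, Matrix.mul_assoc]
  have h2 : ∑ j ∈ range k, (∑ i ∈ range (k + 1), c i * H (i + j)) * d (j + 1) =
      (∑ i ∈ range k, ∑ j ∈ range k, c (i + 1) * H (i + j + 1) * d (j + 1)) +
        c 0 * ∑ j ∈ range k, H j * d (j + 1) := by
    rw [mul_sum, sum_comm, ← sum_add_distrib]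
    refine sum_congr rfl fun i _ => ?_
    rw [sum_range_succ', add_mul, sum_mul]
    simp [Matrix.mul_assoc, add_right_comm]
  -- The common double sum over H_{i+j+1} cancels, leaving the boundary terms.
  rw [h1, h2]
  abel

/-- J pairs the first half of each row with the second half of the other, which produces exactly the
boundary terms of `shift_pairing`. Since `coef H l` vanishes beyond l, its sums can be extended to
length k. -/
theorem lagr_mul_matJ_mul_lagr {k l : ℕ} (hlk : l ≤ k) (hH : ∀ j ≤ 2 * k, (H j)ᴴ = H j) :
    lagr H k * matJ p * (lagr H l)ᴴ = -Complex.I •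
      (∑ i ∈ range k, coef H k (i + 1) * (∑ j ∈ range (k + 1), coef H l j * H (j + i))ᴴ -
        ∑ j ∈ range k, (∑ i ∈ range (k + 1), coef H k i * H (i + j)) * (coef H l (j + 1))ᴴ) := by
  have h1 : ∑ i ∈ range k, coef H k (i + 1) * (∑ j ∈ range (k + 1), coef H l j * H (j + i))ᴴ =
      ∑ i ∈ range k, coef H k (i + 1) * ∑ j ∈ range (k + 1), H (j + i) * (coef H l j)ᴴ := by
    refine sum_congr rfl fun i hi => ?_
    rw [Matrix.conjTranspose_sum]
    congr 1
    refine sum_congr rfl fun j hj => ?_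
    rw [Matrix.conjTranspose_mul, hH]
    rw [mem_range] at hi hj
    omega
  have h2 : (∑ j ∈ range l, coef H l (j + 1) * H j)ᴴ =
      ∑ j ∈ range k, H j * (coef H l (j + 1))ᴴ := by
    rw [Matrix.conjTranspose_sum, ← sum_subset (range_subset_range.2 hlk)]
    · refine sum_congr rfl fun j hj => ?_
      rw [Matrix.conjTranspose_mul, hH]
      rw [mem_range] at hj
      omega
    · intro j _ hj
      rw [coef_of_lt]
      · simp
      · rw [mem_range] at hj
        omega
  rw [h1, ← shift_pairing (coef H k) (fun j => (coef H l j)ᴴ) k, lagr, lagr,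
    fromCols_mul_matJ_mul, Matrix.conjTranspose_smul, h2]
  simp [sub_eq_add_neg]

theorem sum_coef_mul_eq_zero {k : ℕ} (hk : IsUnit (blockHankel H k).det)
    (hH : ∀ j < 2 * k, (H j)ᴴ = H j) (d : ℕ → Matrix (Fin p) (Fin p) ℂ) :
    ∑ j ∈ range k, (∑ i ∈ range (k + 1), coef H k i * H (i + j)) * d j = 0 := by
  refine sum_eq_zero fun j hj => ?_
  rw [mem_range] at hj
  rw [sum_coef_mul_of_lt hk hj (hH _ (by omega)), Matrix.zero_mul]

theorem lagr_isotropic {k : ℕ} (hk : IsUnit (blockHankel H k).det)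
    (hH : ∀ j ≤ 2 * k, (H j)ᴴ = H j) : lagr H k * matJ p * (lagr H k)ᴴ = 0 := by
  have h1 := sum_coef_mul_eq_zero hk (fun j hj => hH j (by omega))
  have h2 := congrArg Matrix.conjTranspose (h1 fun i => (coef H k (i + 1))ᴴ)
  rw [Matrix.conjTranspose_sum] at h2
  simp only [Matrix.conjTranspose_mul _ (coef H k _)ᴴ, Matrix.conjTranspose_conjTranspose] at h2
  rw [lagr_mul_matJ_mul_lagr le_rfl hH, h1, h2]
  simp

/-- Orthogonality kills every term except i = k of the first sum, where the leading coefficient 1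
meets h_k^* = h_k. -/
theorem lagr_succ_mul_lagr {k : ℕ} (hk : (blockHankel H (k + 1)).PosDef)
    (hH : ∀ j ≤ 2 * (k + 1), (H j)ᴴ = H j) :
    lagr H (k + 1) * matJ p * (lagr H k)ᴴ = -Complex.I • schur H k := by
  rw [lagr_mul_matJ_mul_lagr k.le_succ hH,
    sum_coef_mul_eq_zero (isUnit_det_of_posDef hk) (fun j hj => hH j (by omega)), sub_zero]
  congr 1
  have h1 (i : ℕ) : ∑ j ∈ range (k + 1 + 1), coef H k j * H (j + i) =
      ∑ j ∈ range (k + 1), coef H k j * H (j + i) := by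
    rw [sum_range_succ, coef_of_lt H k.lt_succ_self, Matrix.zero_mul, add_zero]
  simp only [h1]
  rw [sum_range_succ, coef_self, Matrix.one_mul, sum_coef_mul_self, (posDef_schur hk).1.eq,
    add_eq_right]
  refine sum_eq_zero fun i hi => ?_
  rw [mem_range] at hi
  rw [sum_coef_mul_of_lt (isUnit_det_of_posDef (posDef_blockHankel_mono k.le_succ hk)) hi
    (hH _ (by omega))]
  simp

theorem lagr_mul_lagr_succ {k : ℕ} (hk : (blockHankel H (k + 1)).PosDef)
    (hH : ∀ j ≤ 2 * (k + 1), (H j)ᴴ = H j) :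
    lagr H k * matJ p * (lagr H (k + 1))ᴴ = Complex.I • schur H k := by
  have h := congrArg Matrix.conjTranspose (lagr_succ_mul_lagr hk hH)
  have hJ : (matJ p)ᴴ = matJ p := by simp [matJ, Matrix.fromBlocks_conjTranspose]
  rw [Matrix.conjTranspose_smul, (posDef_schur hk).1.eq, Matrix.conjTranspose_mul,
    Matrix.conjTranspose_mul, Matrix.conjTranspose_conjTranspose, hJ, ← Matrix.mul_assoc] at h
  simpa using h

/-- Two rows `Y`, `W` that are isotropic for `J` and paired by an invertible `h` span
everything. -/
theorem eq_add_of_isotropic {Y W Z : Matrix (Fin p) (Fin p ⊕ Fin p) ℂ}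
    {h : Matrix (Fin p) (Fin p) ℂ} (hh : IsUnit h.det)
    (hY : Y * matJ p * Yᴴ = 0) (hW : W * matJ p * Wᴴ = 0)
    (hYW : Y * matJ p * Wᴴ = Complex.I • h) (hWY : W * matJ p * Yᴴ = -Complex.I • h) :
    Z = -Complex.I • (Z * matJ p * Wᴴ * h⁻¹ * Y) +
      Complex.I • (Z * matJ p * Yᴴ * h⁻¹ * W) := by
  -- K inverts the Gram matrix of the rows Y, W with respect to J. The stacked matrix is square, so
  -- its right inverse is also a left inverse, which gives the expansion of Z.
  let K : Matrix (Fin p ⊕ Fin p) (Fin p ⊕ Fin p) ℂ :=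
    Matrix.fromBlocks 0 (Complex.I • h⁻¹) (-Complex.I • h⁻¹) 0
  have h1 : Matrix.fromRows Y W * (matJ p * (Matrix.fromRows Y W)ᴴ * K) = 1 := by
    rw [← Matrix.mul_assoc, ← Matrix.mul_assoc,
      Matrix.conjTranspose_fromRows_eq_fromCols_conjTranspose, Matrix.fromRows_mul,
      Matrix.fromRows_mul_fromCols, hY, hW, hYW, hWY, Matrix.fromBlocks_multiply]
    simp [smul_smul, Matrix.mul_nonsing_inv _ hh]
  have h2 := congrArg (fun M => Z * M) (mul_eq_one_comm.1 h1)
  simp only [Matrix.mul_one] at h2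
  conv_lhs => rw [← h2]
  rw [← Matrix.mul_assoc, ← Matrix.mul_assoc, ← Matrix.mul_assoc,
    Matrix.conjTranspose_fromRows_eq_fromCols_conjTranspose, Matrix.mul_fromCols,
    Matrix.fromCols_mul_fromBlocks, Matrix.fromCols_mul_fromRows]
  simp

end Pairing

/-! ### Dependence of h_k and Y_k on the blocks -/

section Modification

variable {p : ℕ} {H H' : ℕ → Matrix (Fin p) (Fin p) ℂ}

theorem blockHankel_congr {m : ℕ} (h : ∀ j, j + 1 < 2 * m → H' j = H j) :
    blockHankel H' m = blockHankel H m := by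
  ext ⟨a, b⟩ ⟨c, d⟩
  simp [blockHankel, h (a + c) (by omega)]

theorem colH₁₂_congr {k : ℕ} (h : ∀ j < 2 * k, H' j = H j) : colH₁₂ H' k = colH₁₂ H k := by
  ext ⟨a, b⟩ c
  simp [colH₁₂, h (k + a) (by omega)]

theorem schur_congr {k : ℕ} (h : ∀ j ≤ 2 * k, H' j = H j) : schur H' k = schur H k := by
  rw [schur, schur, h _ le_rfl, colH₁₂_congr fun j hj => h j hj.le, matT, matT,
    blockHankel_congr fun j hj => h j (by omega)]

/-- The strict bound matters: Y_k does not see H_{2k}, which stays free to prescribe h_k. -/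
theorem lagr_congr {k : ℕ} (h : ∀ j < 2 * k, H' j = H j) : lagr H' k = lagr H k := by
  have hc (j : ℕ) : coef H' k j = coef H k j := by
    rw [coef, coef, colH₁₂_congr h, matT, matT, blockHankel_congr fun j hj => h j (by omega)]
  simp only [lagr, hc]
  congr 2
  refine sum_congr rfl fun j hj => ?_
  rw [mem_range] at hj
  rw [h j (by omega)]

/-- Adding `D` to the block `H_{2k+1}` subtracts `D h_k⁻¹ Y_k` from `Y_{k+1}`. -/
theorem lagr_succ_of_add {k : ℕ} {D : Matrix (Fin p) (Fin p) ℂ}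
    (hk : (blockHankel H (k + 1)).PosDef) (h : ∀ j < 2 * k + 1, H' j = H j)
    (hD : H' (2 * k + 1) = H (2 * k + 1) + Dᴴ) :
    lagr H' (k + 1) = lagr H (k + 1) - D * (schur H k)⁻¹ * lagr H k := by
  have hP : matP₂ p (k + 1) * matT H (k + 1) = (schur H k)⁻¹ * coefRow H k (k + 1) := by
    rw [← schur_mul_matP₂_mul_matT
        (isUnit_det_of_posDef (posDef_blockHankel_mono k.le_succ hk)) (isUnit_det_of_posDef hk)
        fun j hj => conjTranspose_of_posDef hk (by omega),
        Matrix.nonsing_inv_mul_cancel_left _ _ (isUnit_det_of_posDef (posDef_schur hk))]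
  have hT : matT H' (k + 1) = matT H (k + 1) := by
    rw [matT, matT, blockHankel_congr fun j hj => h j (by omega)]
  -- H_{2k+1} is the last block of the column and enters through its adjoint, hence Dᴴ in `hD`.
  have hcol : (colH₁₂ H' (k + 1))ᴴ = (colH₁₂ H (k + 1))ᴴ + D * matP₂ p (k + 1) := by
    ext a ⟨i, b⟩
    rcases (Nat.lt_succ_iff.1 i.2).lt_or_eq with hi | hi
    · simp [colH₁₂, h (k + 1 + i) (by omega), Matrix.mul_apply, matP₂, hi.ne]
    · have : k + 1 + k = 2 * k + 1 := by omega
      simp [colH₁₂, hi, this, hD, Matrix.mul_apply, matP₂, Matrix.one_apply]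
  have hc (j : ℕ) : coef H' (k + 1) j = coef H (k + 1) j - D * (schur H k)⁻¹ * coef H k j := by
    by_cases hj : j < k + 1
    · ext a b
      have hr : (colH₁₂ H' (k + 1))ᴴ * matT H' (k + 1) =
          (colH₁₂ H (k + 1))ᴴ * matT H (k + 1) +
            D * (schur H k)⁻¹ * coefRow H k (k + 1) := by
        rw [hT, hcol, Matrix.add_mul, Matrix.mul_assoc D, hP, Matrix.mul_assoc]
      have := congrFun (congrFun hr a) (⟨j, hj⟩, b)
      simp only [coef, hj, dif_pos, Matrix.neg_apply, Matrix.of_apply, this, Matrix.sub_apply,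
        Matrix.add_apply, neg_add, ← sub_eq_add_neg]
      rfl
    · rw [coef_of_lt H (by omega : k < j), coef, coef, dif_neg hj, dif_neg hj]
      simp
  have hs : ∑ j ∈ range (k + 1), coef H k (j + 1) * H j =
      ∑ j ∈ range k, coef H k (j + 1) * H j := by
    rw [sum_range_succ, coef_of_lt H k.lt_succ_self, Matrix.zero_mul, add_zero]
  have hs' : ∑ j ∈ range (k + 1), coef H' (k + 1) (j + 1) * H' j =
      ∑ j ∈ range (k + 1), coef H (k + 1) (j + 1) * H j -
        D * (schur H k)⁻¹ * ∑ j ∈ range k, coef H k (j + 1) * H j := by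
    rw [← hs, mul_sum, ← sum_sub_distrib]
    refine sum_congr rfl fun j hj => ?_
    rw [mem_range] at hj
    rw [hc, h j (by omega), Matrix.sub_mul, Matrix.mul_assoc _ (coef H k _)]
  rw [lagr, lagr, lagr, hs', hc, Matrix.mul_fromCols]
  ext a (b | b)
  · simp [mul_sub]; ring
  · simp

end Modification

/-! ### Passing between Hankel matrices and rows γ_k -/

section Construction

variable {p : ℕ}

open scoped MatrixOrder in
theorem exists_conjTranspose_mul_self {A : Matrix (Fin p) (Fin p) ℂ} (hA : A.PosDef) :
    ∃ s : Matrix (Fin p) (Fin p) ℂ, sᴴ * s = A ∧ IsUnit s.det := by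
  obtain ⟨s, hs⟩ := CStarAlgebra.nonneg_iff_eq_star_mul_self.mp hA.posSemidef.nonneg
  refine ⟨s, hs.symm, ?_⟩
  have := isUnit_det_of_posDef hA
  rw [hs, Matrix.det_mul] at this
  exact isUnit_of_mul_isUnit_right this

theorem posDef_blockHankel_zero (H : ℕ → Matrix (Fin p) (Fin p) ℂ) :
    (blockHankel H 0).PosDef :=
  ⟨by ext ⟨a, _⟩; exact a.elim0, fun x hx => absurd (Subsingleton.elim x 0) hx⟩

/-- `γ` is the row `Y_k` of `H` up to a left factor `v` with `v^* v = h_k⁻¹`. -/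
def IsFactor (H : ℕ → Matrix (Fin p) (Fin p) ℂ) (k : ℕ)
    (γ : Matrix (Fin p) (Fin p ⊕ Fin p) ℂ) : Prop :=
  ∃ v : Matrix (Fin p) (Fin p) ℂ, vᴴ * v = (schur H k)⁻¹ ∧ IsUnit v.det ∧ γ = v * lagr H k

theorem IsFactor.hankelHamiltonian_eq {H : ℕ → Matrix (Fin p) (Fin p) ℂ} {k : ℕ}
    {γ : Matrix (Fin p) (Fin p ⊕ Fin p) ℂ} (h : IsFactor H k γ)
    (hk : (blockHankel H (k + 1)).PosDef) : hankelHamiltonian H k = γᴴ * γ := by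
  obtain ⟨v, hv, -, rfl⟩ := h
  rw [HankelCanonical.hankelHamiltonian_eq hk, ← hv, Matrix.conjTranspose_mul]
  simp only [Matrix.mul_assoc]

theorem IsFactor.congr {H H' : ℕ → Matrix (Fin p) (Fin p) ℂ} {k : ℕ}
    {γ : Matrix (Fin p) (Fin p ⊕ Fin p) ℂ} (h : IsFactor H k γ)
    (hH : ∀ j ≤ 2 * k, H' j = H j) : IsFactor H' k γ := by
  rwa [IsFactor, schur_congr hH, lagr_congr fun j hj => hH j hj.le]

theorem posDef_inv_conjTranspose_mul_self {u : Matrix (Fin p) (Fin p) ℂ} (hu : IsUnit u.det) :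
    (uᴴ * u)⁻¹.PosDef :=
  (Matrix.PosDef.conjTranspose_mul_self u (Matrix.mulVec_injective_of_isUnit
    ((Matrix.isUnit_iff_isUnit_det u).2 hu))).inv

/-- The one-step extension of a Hankel sequence realizing a prescribed isotropic row. -/
theorem exists_extension {H : ℕ → Matrix (Fin p) (Fin p) ℂ} {k : ℕ}
    (hk : (blockHankel H (k + 1)).PosDef) (hH : ∀ j, (H j)ᴴ = H j)
    (h0 : ∀ j, 2 * k < j → H j = 0) {γ' γ : Matrix (Fin p) (Fin p ⊕ Fin p) ℂ}
    (hγ' : IsFactor H k γ') (hγ : γ * matJ p * γᴴ = 0) (hdet : (γ' * matJ p * γᴴ).det ≠ 0) :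
    ∃ H' : ℕ → Matrix (Fin p) (Fin p) ℂ, (∀ j ≤ 2 * k, H' j = H j) ∧ (∀ j, (H' j)ᴴ = H' j) ∧
      (∀ j, 2 * (k + 1) < j → H' j = 0) ∧ (blockHankel H' (k + 1 + 1)).PosDef ∧
      IsFactor H' (k + 1) γ := by
  have hs := posDef_schur hk
  have hsu := isUnit_det_of_posDef hs
  have hWY := lagr_succ_mul_lagr hk fun j _ => hH j
  have hYW := lagr_mul_lagr_succ hk fun j _ => hH j
  have hW := lagr_isotropic (isUnit_det_of_posDef hk) fun j _ => hH j
  have hY := lagr_isotropic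
    (isUnit_det_of_posDef (posDef_blockHankel_mono k.le_succ hk)) fun j _ => hH j
  have hdec := eq_add_of_isotropic (Z := γ) hsu hY hW hYW hWY
  set Y := lagr H k
  set W := lagr H (k + 1)
  set h := schur H k
  have hJ : (matJ p)ᴴ = matJ p := by simp [matJ, Matrix.fromBlocks_conjTranspose]
  set u := Complex.I • (γ * matJ p * Yᴴ * h⁻¹) with hu
  set A := -Complex.I • (γ * matJ p * Wᴴ * h⁻¹) with hA
  have hγA : γ = A * Y + u * W := by
    rw [hA, hu, Matrix.smul_mul, Matrix.smul_mul, ← hdec]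
  -- Up to the factor v, γ' J γ^* is the adjoint of γ J Y^*, and u = i γ J Y^* h⁻¹.
  have huu : IsUnit u.det := by
    obtain ⟨v, -, -, rfl⟩ := hγ'
    rw [Matrix.mul_assoc, Matrix.mul_assoc, Matrix.det_mul, ← Matrix.mul_assoc] at hdet
    have h1 : (γ * matJ p * Yᴴ).det ≠ 0 := by
      have := right_ne_zero_of_mul hdet
      rw [← star_ne_zero, ← Matrix.det_conjTranspose, Matrix.conjTranspose_mul,
        Matrix.conjTranspose_mul, Matrix.conjTranspose_conjTranspose, hJ,
        ← Matrix.mul_assoc] at this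
      exact this
    rw [hu, Matrix.det_smul, Matrix.det_mul]
    exact ((pow_ne_zero _ Complex.I_ne_zero).isUnit).mul
      (h1.isUnit.mul (isUnit_det_of_posDef hs.inv))
  have hsym : A * h * uᴴ = u * h * Aᴴ := by
    have h1 := hγ
    rw [hγA, Matrix.conjTranspose_add, Matrix.conjTranspose_mul, Matrix.conjTranspose_mul] at h1
    have h2 : (A * Y + u * W) * matJ p * (Yᴴ * Aᴴ + Wᴴ * uᴴ) =
        A * (Y * matJ p * Yᴴ) * Aᴴ + A * (Y * matJ p * Wᴴ) * uᴴ +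
          (u * (W * matJ p * Yᴴ) * Aᴴ + u * (W * matJ p * Wᴴ) * uᴴ) := by
      simp only [Matrix.add_mul, Matrix.mul_add, Matrix.mul_assoc]
      abel
    rw [h2, hY, hW, hYW, hWY] at h1
    have h3 : Complex.I • (A * h * uᴴ - u * h * Aᴴ) = 0 := by
      rw [← h1]
      simp [sub_eq_add_neg]
    exact sub_eq_zero.1 ((smul_eq_zero.1 h3).resolve_left Complex.I_ne_zero)
  -- Chosen so that W - D h⁻¹ Y = u⁻¹ γ; the relation `hsym` makes it Hermitian.
  set D := -(u⁻¹ * A * h) with hDdef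
  have hD : Dᴴ = D := by
    have hu' : IsUnit (uᴴ).det := by
      rw [Matrix.det_conjTranspose]
      exact huu.star
    rw [hDdef, Matrix.conjTranspose_neg, Matrix.conjTranspose_mul, Matrix.conjTranspose_mul,
      hs.1.eq, Matrix.conjTranspose_nonsing_inv, neg_inj]
    have h1 : u⁻¹ * (A * h * uᴴ) * (uᴴ)⁻¹ = u⁻¹ * (u * h * Aᴴ) * (uᴴ)⁻¹ := by rw [hsym]
    rw [Matrix.mul_assoc u h, Matrix.nonsing_inv_mul_cancel_left _ _ huu, ← Matrix.mul_assoc,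
      Matrix.mul_nonsing_inv_cancel_right _ _ hu', Matrix.mul_assoc h] at h1
    rw [← h1, Matrix.mul_assoc]
  let H₁ : ℕ → Matrix (Fin p) (Fin p) ℂ := Function.update H (2 * k + 1) D
  -- The last block is chosen so that the Schur complement equals (u^* u)⁻¹.
  let H' : ℕ → Matrix (Fin p) (Fin p) ℂ := Function.update H₁ (2 * (k + 1))
    ((uᴴ * u)⁻¹ + (colH₁₂ H₁ (k + 1))ᴴ * matT H (k + 1) * colH₁₂ H₁ (k + 1))
  have hH₁ : ∀ j < 2 * (k + 1), H' j = H₁ j := fun j hj => Function.update_of_ne hj.ne _ _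
  have hH₀ : ∀ j < 2 * k + 1, H' j = H j := fun j hj => by
    rw [hH₁ j (by omega)]
    exact Function.update_of_ne hj.ne _ _
  have hlagr : lagr H' (k + 1) = W - D * h⁻¹ * Y := by
    refine lagr_succ_of_add hk hH₀ ?_
    rw [hH₁ _ (by omega), h0 _ (by omega), zero_add, hD]
    exact Function.update_self _ _ _
  have hT : matT H' (k + 1) = matT H (k + 1) := by
    rw [matT, matT, blockHankel_congr fun j hj => hH₀ j (by omega)]
  have hschur : schur H' (k + 1) = (uᴴ * u)⁻¹ := by
    rw [schur, colH₁₂_congr hH₁, hT]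
    simp [H']
  have hpos := posDef_inv_conjTranspose_mul_self huu
  have hHer : ∀ j, (H' j)ᴴ = H' j := by
    intro j
    by_cases h1 : j = 2 * (k + 1)
    · subst h1
      have h2 := hpos.1.add (Matrix.isHermitian_conjTranspose_mul_mul
        (colH₁₂ H₁ (k + 1)) hk.inv.1)
      rw [← matT] at h2
      simpa [H'] using h2.eq
    · by_cases h2 : j = 2 * k + 1
      · subst h2
        rw [hH₁ _ (by omega)]
        simpa [H₁] using hD
      · simpa [H', H₁, h1, h2] using hH j
  refine ⟨H', fun j hj => hH₀ j (by omega), hHer, ?_, ?_, ?_⟩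
  · intro j hj
    rw [← h0 j (by omega)]
    simp only [H', H₁]
    rw [Function.update_of_ne (by omega), Function.update_of_ne (by omega)]
  · refine posDef_blockHankel_succ ?_ (fun j _ => hHer j) (hschur ▸ hpos)
    rwa [blockHankel_congr fun j hj => hH₀ j (by omega)]
  · refine ⟨u, ?_, huu, ?_⟩
    · rw [hschur, Matrix.nonsing_inv_nonsing_inv]
      rw [Matrix.det_mul, Matrix.det_conjTranspose]
      exact huu.star.mul huu
    · rw [hlagr, hDdef, Matrix.neg_mul, Matrix.neg_mul, sub_neg_eq_add,
        Matrix.mul_nonsing_inv_cancel_right _ _ hsu, Matrix.mul_add, Matrix.mul_assoc u⁻¹,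
        Matrix.mul_nonsing_inv_cancel_left _ _ huu, add_comm]
      exact hγA

theorem exists_hankel_of_rows {n : ℕ} (hn : 1 ≤ n)
    {γ : Fin n → Matrix (Fin p) (Fin p ⊕ Fin p) ℂ} (h0 : γ ⟨0, hn⟩ * colFst p = 0)
    (hJ : ∀ k : Fin n, 0 < (k : ℕ) → γ k * matJ p * (γ k)ᴴ = 0)
    (hdet : ∀ (k : ℕ) (hk : k + 1 < n),
      (γ ⟨k, Nat.lt_of_succ_lt hk⟩ * matJ p * (γ ⟨k + 1, hk⟩)ᴴ).det ≠ 0)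
    (h1 : n = 1 → (γ ⟨0, hn⟩ * colSnd p).det ≠ 0) (k : ℕ) (hk : k < n) :
    ∃ H : ℕ → Matrix (Fin p) (Fin p) ℂ, (∀ j, (H j)ᴴ = H j) ∧ (∀ j, 2 * k < j → H j = 0) ∧
      (blockHankel H (k + 1)).PosDef ∧
      ∀ j (hj : j ≤ k), IsFactor H j (γ ⟨j, hj.trans_lt hk⟩) := by
  induction k with
  | zero =>
    have hg : γ ⟨0, hn⟩ = γ ⟨0, hn⟩ * colSnd p * (colSnd p)ᴴ := by
      have h2 : colFst p * (colFst p)ᴴ + colSnd p * (colSnd p)ᴴ = 1 := by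
        rw [colFst, colSnd, Matrix.conjTranspose_fromRows_eq_fromCols_conjTranspose,
          Matrix.conjTranspose_fromRows_eq_fromCols_conjTranspose,
          Matrix.fromRows_mul_fromCols, Matrix.fromRows_mul_fromCols, Matrix.fromBlocks_add]
        simp
      conv_lhs => rw [← Matrix.mul_one (γ ⟨0, hn⟩), ← h2, Matrix.mul_add, ← Matrix.mul_assoc,
        ← Matrix.mul_assoc, h0, Matrix.zero_mul, zero_add]
    set g := γ ⟨0, hn⟩ * colSnd p with hgdef
    -- For n > 1 invertibility of g is already forced by det(γ_0 J γ_1^*) ≠ 0, because γ_0 = g [0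
    -- I]; only n = 1 needs the extra hypothesis.
    have hgu : IsUnit g.det := by
      rw [isUnit_iff_ne_zero]
      rcases hn.eq_or_lt with h2 | h2
      · exact h1 h2.symm
      · have h3 := hdet 0 h2
        rw [hg, Matrix.mul_assoc, Matrix.mul_assoc, Matrix.det_mul] at h3
        exact left_ne_zero_of_mul h3
    have hpos := posDef_inv_conjTranspose_mul_self hgu
    let H : ℕ → Matrix (Fin p) (Fin p) ℂ := fun j => if j = 0 then (gᴴ * g)⁻¹ else 0
    have hH : ∀ j, (H j)ᴴ = H j := by
      intro j
      by_cases hj : j = 0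
      · simpa [H, hj] using hpos.1.eq
      · simp [H, hj]
    have hsch : schur H 0 = (gᴴ * g)⁻¹ := by simp [schur_zero, H]
    refine ⟨H, hH, fun j hj => if_neg (by omega),
      posDef_blockHankel_succ (posDef_blockHankel_zero H) (fun j _ => hH j) (hsch ▸ hpos), ?_⟩
    intro j hj
    obtain rfl := Nat.le_zero.1 hj
    refine ⟨g, ?_, hgu, by rw [lagr_zero]; exact hg⟩
    rw [hsch, Matrix.nonsing_inv_nonsing_inv]
    rw [Matrix.det_mul, Matrix.det_conjTranspose]
    exact hgu.star.mul hgu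
  | succ k ih =>
    obtain ⟨H, hH, hz, hpos, hf⟩ := ih (by omega)
    obtain ⟨H', ha, hH', hz', hpos', hf'⟩ :=
      exists_extension hpos hH hz (hf k le_rfl) (hJ ⟨k + 1, hk⟩ k.succ_pos) (hdet k hk)
    refine ⟨H', hH', hz', hpos', fun j hj => ?_⟩
    rcases hj.lt_or_eq with h2 | rfl
    · exact (hf j (by omega)).congr fun i hi => ha i (by omega)
    · exact hf'

theorem exists_rows_of_hankel {n : ℕ} (hn : 1 ≤ n) {H : ℕ → Matrix (Fin p) (Fin p) ℂ}
    (hpos : (blockHankel H n).PosDef) :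
    ∃ γ : Fin n → Matrix (Fin p) (Fin p ⊕ Fin p) ℂ,
      (∀ k : Fin n, IsFactor H k (γ k)) ∧ γ ⟨0, hn⟩ * colFst p = 0 ∧
      (∀ k : Fin n, γ k * matJ p * (γ k)ᴴ = 0) ∧
      (∀ (k : ℕ) (hk : k + 1 < n),
        (γ ⟨k, Nat.lt_of_succ_lt hk⟩ * matJ p * (γ ⟨k + 1, hk⟩)ᴴ).det ≠ 0) ∧
      (γ ⟨0, hn⟩ * colSnd p).det ≠ 0 := by
  have hp (k : ℕ) (hk : k ≤ n) := posDef_blockHankel_mono hk hpos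
  have hH (j : ℕ) (hj : j + 1 < 2 * n) := conjTranspose_of_posDef hpos hj
  have hex (k : Fin n) := exists_conjTranspose_mul_self (posDef_schur (hp (k + 1) k.2)).inv
  choose v hv hvu using hex
  refine ⟨fun k => v k * lagr H k, fun k => ⟨v k, hv k, hvu k, rfl⟩, ?_, ?_, ?_, ?_⟩
  · change v ⟨0, hn⟩ * lagr H 0 * colFst p = 0
    rw [lagr_zero, Matrix.mul_assoc]
    simp [colFst, colSnd, Matrix.conjTranspose_fromRows_eq_fromCols_conjTranspose,
      Matrix.fromCols_mul_fromRows]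
  · intro k
    have h1 := lagr_isotropic (isUnit_det_of_posDef (hp k k.2.le))
      fun j hj => hH j (by omega)
    have h2 : v k * lagr H k * matJ p * (v k * lagr H k)ᴴ =
        v k * (lagr H k * matJ p * (lagr H k)ᴴ) * (v k)ᴴ := by
      simp only [Matrix.conjTranspose_mul, Matrix.mul_assoc]
    rw [h2, h1, Matrix.mul_zero, Matrix.zero_mul]
  · intro k hk
    have hs := posDef_schur (hp (k + 1) (by omega))
    have h1 := lagr_mul_lagr_succ (hp (k + 1) (by omega)) fun j hj => hH j (by omega)
    have h2 (a b : Matrix (Fin p) (Fin p) ℂ) :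
        a * lagr H k * matJ p * (b * lagr H (k + 1))ᴴ =
          a * (lagr H k * matJ p * (lagr H (k + 1))ᴴ) * bᴴ := by
      simp only [Matrix.conjTranspose_mul, Matrix.mul_assoc]
    rw [h2, h1, Matrix.det_mul, Matrix.det_mul, Matrix.det_smul, Matrix.det_conjTranspose]
    exact mul_ne_zero (mul_ne_zero (hvu _).ne_zero (mul_ne_zero
      (pow_ne_zero _ Complex.I_ne_zero) (isUnit_det_of_posDef hs).ne_zero))
      (hvu _).star.ne_zero
  · have h1 : (colSnd p)ᴴ * colSnd p = 1 := by
      simp [colSnd, Matrix.conjTranspose_fromRows_eq_fromCols_conjTranspose,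
        Matrix.fromCols_mul_fromRows]
    change (v ⟨0, hn⟩ * lagr H 0 * colSnd p).det ≠ 0
    rw [lagr_zero, Matrix.mul_assoc, h1, Matrix.mul_one]
    exact (hvu _).ne_zero

end Construction

end HankelCanonical
-- The two inclusions
theorem mainTheorem8 (p n : ℕ) (hn : 1 ≤ n) :
    {S | ∃ H : ℕ → Matrix (Fin p) (Fin p) ℂ,
        (HankelCanonical.blockHankel H n).PosDef ∧
        S = HankelCanonical.canonicalSystem
          (fun k : Fin n => HankelCanonical.hankelHamiltonian H (k : ℕ))} =
    {S | ∃ γ : Fin n → Matrix (Fin p) (Fin p ⊕ Fin p) ℂ,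
        γ ⟨0, hn⟩ * HankelCanonical.colFst p = 0 ∧
        (∀ k : Fin n, 0 < (k : ℕ) →
          γ k * HankelCanonical.matJ p * (γ k).conjTranspose = 0) ∧
        (∀ (k : ℕ) (hk : k + 1 < n),
          (γ ⟨k, Nat.lt_of_succ_lt hk⟩ * HankelCanonical.matJ p *
            (γ ⟨k + 1, hk⟩).conjTranspose).det ≠ 0) ∧
        (n = 1 → (γ ⟨0, hn⟩ * HankelCanonical.colSnd p).det ≠ 0) ∧
        S = HankelCanonical.canonicalSystem
          (fun k : Fin n => (γ k).conjTranspose * γ k)} := by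
  ext S
  constructor
  · rintro ⟨H, hpos, rfl⟩
    obtain ⟨γ, hf, h0, hJ, hdet, h1⟩ := HankelCanonical.exists_rows_of_hankel hn hpos
    refine ⟨γ, h0, fun k _ => hJ k, hdet, fun _ => h1, ?_⟩
    congr 1
    funext k
    exact (hf k).hankelHamiltonian_eq (HankelCanonical.posDef_blockHankel_mono k.2 hpos)
  · rintro ⟨γ, h0, hJ, hdet, h1, rfl⟩
    obtain ⟨n, rfl⟩ := Nat.exists_eq_add_of_le' hn
    obtain ⟨H, -, -, hpos, hf⟩ :=
      HankelCanonical.exists_hankel_of_rows hn h0 hJ hdet h1 n n.lt_succ_self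
    refine ⟨H, hpos, ?_⟩
    congr 1
    funext k
    exact ((hf k (by omega)).hankelHamiltonian_eq
      (HankelCanonical.posDef_blockHankel_mono k.2 hpos)).symm
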